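/- Let $q$ be a prime power. A linear $[n,k,d]_q$-code is a $k$-dimensional subspace $C\subseteq\mathbb{F}_q^n$ in which any two distinct codewords have Hamming distance at least $d$. The code $C$ has locality $r$ if for every coordinate $i\in\{1,\dots,n\}$ there is a set $S_i\subseteq\{1,\dots,n\}\setminus\{i\}$ with $|S_i|\le r$ such that any two codewords $c,c'\in C$ with $c_j=c'_j$ for all $j\in S_i$ satisfy $c_i=c'_i$. Let $n_q(k,d)$ be the minimum length $n$ of an $[n,k,d]_q$-code, and let $n_q(k,d,r)$ be the minimum length $n$ of an $[n,k,d]_q$-code with locality $r$ (the minimum is $\infty$ if there is no such code). Theorem. We have $n_2(4,1,1)=n_2(4,2,1)=8$, $n_2(4,3,1)=n_2(4,4,1)=10$, $n_2(4,5,1)=n_2(4,6,1)=14$, $n_2(4,7,1)=n_2(4,8,1)=16$, $n_2(4,9,1)=20$, $n_2(4,10,1)=22$, $n_2(4,11,1)=23$, $n_2(4,12,1)=24$, $n_2(4,13,1)=27$, $n_2(4,14,1)=28$, $n_2(4,15,1)=30$, and $n_2(4,d,1)=n_2(4,d)<\infty$ for all integers $d\ge 16$. -/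

import Mathlib

/-- `IsCode C k d`: the subspace `C` of `F^n` is an `[n, k, d]`-code, i.e. it has dimension `k` and
minimum Hamming distance at least `d`. -/
def IsCode {F : Type*} [Field F] [DecidableEq F] {n : ℕ}
    (C : Submodule F (Fin n → F)) (k d : ℕ) : Prop :=
  Module.finrank F C = k ∧ ∀ c ∈ C, ∀ c' ∈ C, c ≠ c' → d ≤ hammingDist c c'

/-- `HasLocality C r`: every coordinate `i` has a recovery set `S` of at most `r` other coordinates,
i.e. codewords that agree on `S` agree at `i`. -/
def HasLocality {F : Type*} [Field F] {n : ℕ}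
    (C : Submodule F (Fin n → F)) (r : ℕ) : Prop :=
  ∀ i : Fin n, ∃ S : Finset (Fin n), i ∉ S ∧ S.card ≤ r ∧
    ∀ c ∈ C, ∀ c' ∈ C, (∀ j ∈ S, c j = c' j) → c i = c' i

/-- The minimum length `n_q(k, d)` of an `[n, k, d]`-code over `F`, with value `⊤` if there is no
such code of any length. -/
noncomputable def minLength (F : Type*) [Field F] [DecidableEq F] (k d : ℕ) : ℕ∞ :=
  ⨅ n ∈ {n : ℕ | ∃ C : Submodule F (Fin n → F), IsCode C k d}, (n : ℕ∞)

/-- The minimum length `n_q(k, d, r)` of an `[n, k, d]`-code over `F` with locality `r`, with value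
`⊤` if there is no such code of any length. -/
noncomputable def minLengthLRC (F : Type*) [Field F] [DecidableEq F] (k d r : ℕ) : ℕ∞ :=
  ⨅ n ∈ {n : ℕ | ∃ C : Submodule F (Fin n → F), IsCode C k d ∧ HasLocality C r}, (n : ℕ∞)

/-!
Up to equivalence, a binary code of dimension 4 is a multiset of vectors of `𝔽₂⁴`, the columns of a
generator matrix; the codeword of the message `v` has as weight the number of columns not
orthogonal to `v`. A coordinate is recovered from a single other one exactly when the two columns
agree (or its column is zero), so locality 1 means that no nonzero vector has multiplicity 1
(`exists_multiplicity`, `exists_code`). Only the multiplicities `m p` of the 15 points of `PG(3, 2)`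
matter.

Counting columns on lines bounds the multiplicity of each line (`line_bound`), then of each point
(`point_bound`); since the average multiplicity cannot exceed the latter, the Griesmer bound
follows (`griesmer`). For `d ≥ 16` it is attained with locality 1: a code of distance `d - 16`
meeting the Griesmer bound, together with two copies of the simplex code, has all multiplicities at
least 2 (`minLengthLRC_le_griesmer`).

For `d ≤ 15` the point bound usually leaves only the multiplicities 0 and 2. Then the length is even
and the Griesmer bound applies to the halved multiset with distance `⌈d / 2⌉`
(`griesmer_of_two_valued`). Multiplicity 3 has to be considered for `(n, d)` equal to `(9, 3)`,
`(13, 5)` and `(21, 10)`; there the parity of the weights, a linear functional of the message, gives a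
contradiction with the total weight on suitable sets of messages (`not_sum_nine_or_thirteen`,
`sum_ne_twentyone`). At `d = 1` the four points needed to span each have multiplicity at least 2.
The codes attaining the bounds are mostly doubled Griesmer codes (`minLengthLRC_le_double`).
-/

/-- The vectors of `𝔽₂⁴`: messages, and columns of generator matrices. -/
abbrev Vec := Fin 4 → ZMod 2

/-- The weight of the codeword of the message `v` in the code whose generator matrix has each
column `p` with multiplicity `m p`. -/
def weight (m : Vec → ℕ) (v : Vec) : ℕ := ∑ p, if v ⬝ᵥ p = 0 then 0 else m p

lemma weight_add (m m' : Vec → ℕ) (v : Vec) : weight (m + m') v = weight m v + weight m' v := by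
  simp only [weight, ← Finset.sum_add_distrib]
  refine Finset.sum_congr rfl fun p _ => ?_
  split_ifs <;> simp

lemma weight_smul (c : ℕ) (m : Vec → ℕ) (v : Vec) : weight (c • m) v = c * weight m v := by
  simp only [weight, Finset.mul_sum]
  refine Finset.sum_congr rfl fun p _ => ?_
  split_ifs <;> simp

lemma weight_zero_right (m : Vec → ℕ) : weight m 0 = 0 := by simp [weight]

/-! ### Codes and column multiplicities -/

/-- A code of dimension 4 is described by the multiplicities of the nonzero columns of a generator
matrix; locality 1 forbids multiplicity 1, since a coordinate can only be recovered from an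
equal one. -/
lemma exists_multiplicity {n d : ℕ} {C : Submodule (ZMod 2) (Fin n → ZMod 2)} (hC : IsCode C 4 d) :
    ∃ m : Vec → ℕ, m 0 = 0 ∧ ∑ p, m p ≤ n ∧ (∀ v ≠ 0, d ≤ weight m v) ∧
      (HasLocality C 1 → ∀ p, m p ≠ 1) := by
  classical
  obtain ⟨hk, hd⟩ := hC
  let e : Vec ≃ₗ[ZMod 2] C := LinearEquiv.ofFinrankEq Vec C (by simp [hk])
  let col : Fin n → Vec := fun i j => (e (Pi.single j 1) : Fin n → ZMod 2) i
  have he : ∀ v i, (e v : Fin n → ZMod 2) i = v ⬝ᵥ col i := by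
    intro v i
    have hv : v = ∑ j, v j • (Pi.single j 1 : Vec) := by
      ext k; simp [Finset.sum_apply, Pi.single_apply]
    conv_lhs => rw [hv]
    simp [col, dotProduct, Finset.sum_apply]
  refine ⟨fun p => if p = 0 then 0 else (Finset.univ.filter fun i => col i = p).card,
    by simp, ?_, ?_, ?_⟩
  · calc _ ≤ ∑ p, (Finset.univ.filter fun i => col i = p).card := by
          refine Finset.sum_le_sum fun p _ => ?_
          split_ifs <;> simp
      _ = n := by
          rw [← Finset.card_eq_sum_card_fiberwise (f := col) (by intro; simp)]
          simp
  · intro v hv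
    have h1 := hd (e v) (e v).2 0 C.zero_mem (by simpa using hv)
    refine h1.trans (le_of_eq ?_)
    simp only [hammingDist_zero_right, hammingNorm, he, weight]
    rw [Finset.card_eq_sum_card_fiberwise (f := col) (t := Finset.univ) (by intro; simp)]
    refine Finset.sum_congr rfl fun p _ => ?_
    rw [Finset.filter_filter]
    split_ifs with h h'
    · rw [Finset.card_eq_zero, Finset.filter_eq_empty_iff]
      rintro i - ⟨h2, rfl⟩
      exact h2 h
    · simp [h'] at h
    · congr 1
      refine Finset.filter_congr fun i _ => ⟨fun h2 => h2.2, ?_⟩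
      rintro rfl
      exact ⟨h, rfl⟩
  · intro hloc p hp
    have hp0 : p ≠ 0 := by rintro rfl; simp at hp
    simp only [if_neg hp0, Finset.card_eq_one] at hp
    obtain ⟨i, hi⟩ := hp
    have hcol : ∀ j, col j = p ↔ j = i := by
      intro j
      have := congrArg (j ∈ ·) hi
      simpa using this
    obtain ⟨S, hiS, hS, hrec⟩ := hloc i
    have hvan : ∀ v, (∀ j ∈ S, v ⬝ᵥ col j = 0) → v ⬝ᵥ p = 0 := by
      intro v hv
      have := hrec (e v) (e v).2 0 C.zero_mem (by simpa [he] using hv)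
      simpa [he, (hcol i).2 rfl] using this
    have hdual : ∀ a b : Vec, (∀ v : Vec, v ⬝ᵥ b = 0 → v ⬝ᵥ a = 0) → a = 0 ∨ a = b := by
      decide +kernel
    have : Nonempty (Fin n) := ⟨i⟩
    rcases Finset.card_le_one_iff_subset_singleton.1 hS with ⟨j, hj⟩
    rcases hdual p (col j) (fun v hv => hvan v fun k hk => by
      rw [Finset.mem_singleton.1 (hj hk)]; exact hv) with h | h
    · exact hp0 h
    · have hji := (hcol j).1 h.symm
      subst hji
      have hS0 : S = ∅ := by
        rw [Finset.eq_empty_iff_forall_notMem]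
        intro k hk
        exact hiS (Finset.mem_singleton.1 (hj hk) ▸ hk)
      exact hp0 ((hdual p 0 fun v _ => hvan v (by simp [hS0])).elim id id)

/-- Conversely, column multiplicities define a code. -/
lemma exists_code (m : Vec → ℕ) {d : ℕ} (hd : 1 ≤ d) (hw : ∀ v ≠ 0, d ≤ weight m v) :
    ∃ C : Submodule (ZMod 2) (Fin (∑ p, m p) → ZMod 2), IsCode C 4 d ∧
      ((∀ p, m p ≠ 1) → HasLocality C 1) := by
  classical
  let e : Fin (∑ p, m p) ≃ Σ p, Fin (m p) := (Fintype.equivFinOfCardEq (by simp)).symm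
  let φ : Vec →ₗ[ZMod 2] (Fin (∑ p, m p) → ZMod 2) :=
    { toFun := fun v i => v ⬝ᵥ (e i).1
      map_add' := fun v w => by ext i; simp [add_dotProduct]
      map_smul' := fun c v => by ext i; simp }
  have hφ : ∀ v i, φ v i = v ⬝ᵥ (e i).1 := fun _ _ => rfl
  have hnorm : ∀ v, hammingNorm (φ v) = weight m v := by
    intro v
    have h1 : hammingNorm (φ v) = ∑ i, if v ⬝ᵥ (e i).1 = 0 then 0 else 1 := by
      simp only [hammingNorm, Finset.card_filter, hφ, ne_eq, ite_not]
    rw [h1, Equiv.sum_comp e (fun x => if v ⬝ᵥ x.1 = 0 then 0 else 1), Fintype.sum_sigma, weight]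
    refine Finset.sum_congr rfl fun p _ => ?_
    split_ifs <;> simp
  have hinj : Function.Injective φ := by
    rw [← LinearMap.ker_eq_bot, LinearMap.ker_eq_bot']
    intro v hv
    by_contra hv0
    have := hw v hv0
    rw [← hnorm, hv, hammingNorm_zero] at this
    omega
  refine ⟨LinearMap.range φ, ⟨by rw [LinearMap.finrank_range_of_inj hinj]; simp, ?_⟩, ?_⟩
  · rintro _ ⟨v, rfl⟩ _ ⟨w, rfl⟩ hne
    rw [hammingDist_eq_hammingNorm, ← map_neg, ← map_add, hnorm]
    refine hw _ fun h => hne ?_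
    rw [neg_add_eq_zero.1 h]
  · intro hm i
    have h2 : 1 < m (e i).1 := by
      have := hm (e i).1
      have := (e i).2.pos
      omega
    have : Nontrivial (Fin (m (e i).1)) := Fin.nontrivial_iff_two_le.2 h2
    obtain ⟨k, hk⟩ := exists_ne (e i).2
    refine ⟨{e.symm ⟨(e i).1, k⟩}, ?_, by simp, ?_⟩
    · rw [Finset.mem_singleton]
      intro h
      have h3 := congrArg e h
      rw [Equiv.apply_symm_apply] at h3
      have h4 := (Sigma.ext_iff.1 h3).2
      exact hk (eq_of_heq h4).symm
    · rintro _ ⟨v, rfl⟩ _ ⟨w, rfl⟩ h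
      have := h _ (Finset.mem_singleton_self _)
      simpa [hφ] using this

lemma minLengthLRC_le {d : ℕ} (N : ℕ) (m : Vec → ℕ) (hd : 1 ≤ d) (hN : ∑ p, m p = N)
    (hm : ∀ p, m p ≠ 1) (hw : ∀ v ≠ 0, d ≤ weight m v) :
    minLengthLRC (ZMod 2) 4 d 1 ≤ N := by
  obtain ⟨C, hC, hloc⟩ := exists_code m hd hw
  subst hN
  exact iInf₂_le _ ⟨C, hC, hloc hm⟩

lemma le_minLengthLRC {d N : ℕ} (h : ∀ m : Vec → ℕ, m 0 = 0 → (∀ v ≠ 0, d ≤ weight m v) →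
    (∀ p, m p ≠ 1) → N ≤ ∑ p, m p) : (N : ℕ∞) ≤ minLengthLRC (ZMod 2) 4 d 1 := by
  refine le_iInf₂ ?_
  rintro n ⟨C, hC, hloc⟩
  obtain ⟨m, h0, hn, hw, hm⟩ := exists_multiplicity hC
  exact_mod_cast (h m h0 hw (hm hloc)).trans hn

lemma le_minLength {d N : ℕ} (h : ∀ m : Vec → ℕ, m 0 = 0 → (∀ v ≠ 0, d ≤ weight m v) →
    N ≤ ∑ p, m p) : (N : ℕ∞) ≤ minLength (ZMod 2) 4 d := by
  refine le_iInf₂ ?_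
  rintro n ⟨C, hC⟩
  obtain ⟨m, h0, hn, hw, -⟩ := exists_multiplicity hC
  exact_mod_cast (h m h0 hw).trans hn

lemma minLength_le_minLengthLRC (d r : ℕ) :
    minLength (ZMod 2) 4 d ≤ minLengthLRC (ZMod 2) 4 d r :=
  le_iInf₂ fun _ ⟨C, hC, _⟩ => iInf₂_le _ ⟨C, hC⟩

/-! ### Counting on lines and points -/

/-- The three points of a line of `PG(3, 2)` carry at most `n - 3d/2` columns: the two independent
functionals vanishing on the line and their sum are nonzero together exactly twice at each other
point. -/
lemma line_bound {m : Vec → ℕ} {d : ℕ} (hw : ∀ v ≠ 0, d ≤ weight m v) {p q : Vec}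
    (hp : p ≠ 0) (hq : q ≠ 0) (hpq : p ≠ q) :
    2 * (m p + m q + m (p + q)) + 3 * d ≤ 2 * ∑ x, m x := by
  have hex : ∀ p q : Vec, ∃ f g : Vec, f ≠ 0 ∧ g ≠ 0 ∧ f + g ≠ 0 ∧ f ⬝ᵥ p = 0 ∧ f ⬝ᵥ q = 0 ∧
      g ⬝ᵥ p = 0 ∧ g ⬝ᵥ q = 0 := by decide +kernel
  obtain ⟨f, g, hf, hg, hfg, hfp, hfq, hgp, hgq⟩ := hex p q
  have hne : p + q ≠ p ∧ p + q ≠ q := ⟨by simpa using hq, by simpa using hp⟩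
  have hline : m p + m q + m (p + q) = ∑ x, if x = p ∨ x = q ∨ x = p + q then m x else 0 := by
    have : (Finset.univ.filter fun x => x = p ∨ x = q ∨ x = p + q) = {p, q, p + q} := by
      ext x; simp
    rw [← Finset.sum_filter, this, Finset.sum_insert, Finset.sum_pair hne.2.symm, add_assoc]
    simp [hpq, hne.1.symm]
  have hsum : 2 * (m p + m q + m (p + q)) + (weight m f + weight m g + weight m (f + g)) ≤
      2 * ∑ x, m x := by
    rw [hline]
    simp only [weight, Finset.mul_sum, ← Finset.sum_add_distrib]
    refine Finset.sum_le_sum fun x _ => ?_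
    have hz : ∀ a b : ZMod 2, a ≠ 0 → b ≠ 0 → a + b = 0 := by decide
    by_cases hx : x = p ∨ x = q ∨ x = p + q
    · have hfx : f ⬝ᵥ x = 0 := by
        rcases hx with rfl | rfl | rfl <;> simp [dotProduct_add, *]
      have hgx : g ⬝ᵥ x = 0 := by
        rcases hx with rfl | rfl | rfl <;> simp [dotProduct_add, *]
      simp [hx, hfx, hgx, add_dotProduct]
    · rw [if_neg hx, add_dotProduct]
      by_cases hfx : f ⬝ᵥ x = 0 <;> by_cases hgx : g ⬝ᵥ x = 0
      · simp [hfx, hgx]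
      · simp [hfx, hgx, two_mul]
      · simp [hfx, hgx, two_mul]
      · simp [hfx, hgx, hz _ _ hfx hgx, two_mul]
  have := hw f hf
  have := hw g hg
  have := hw _ hfg
  omega

/-- Adding up the line bound over the seven lines through a point. -/
lemma point_bound {m : Vec → ℕ} {d : ℕ} (h0 : m 0 = 0) (hw : ∀ v ≠ 0, d ≤ weight m v) {p : Vec}
    (hp : p ≠ 0) : 6 * m p + ∑ x, m x ≤ 7 * ((2 * ∑ x, m x - 3 * d) / 2) := by
  set L := (2 * ∑ x, m x - 3 * d) / 2
  have hcard : ∀ p : Vec, p ≠ 0 → (Finset.univ.filter fun q => q = 0 ∨ q = p).card = 2 ∧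
      (Finset.univ.filter fun q => ¬(q = 0 ∨ q = p)).card = 14 := by decide +kernel
  have hself : ∀ p : Vec, p + p = 0 := by decide +kernel
  have h1 : ∑ q, (m p + m q + m (p + q)) ≤ ∑ q, if q = 0 ∨ q = p then 2 * m p else L := by
    refine Finset.sum_le_sum fun q _ => ?_
    split_ifs with h
    · rcases h with rfl | rfl
      · simp [h0, two_mul]
      · simp [h0, two_mul, hself]
    · rw [not_or] at h
      have := line_bound hw hp h.1 (Ne.symm h.2)
      omega
  have h2 : ∑ q, m (p + q) = ∑ q, m q := Equiv.sum_comp (Equiv.addLeft p) m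
  rw [Finset.sum_add_distrib, Finset.sum_add_distrib, h2, Finset.sum_ite, Finset.sum_const,
    Finset.sum_const, Finset.sum_const, (hcard p hp).1, (hcard p hp).2] at h1
  simp only [Finset.card_univ, Fintype.card_pi, ZMod.card, Finset.prod_const, Fintype.card_fin,
    smul_eq_mul] at h1
  omega

/-- The Griesmer bound for binary codes of dimension 4: the average multiplicity of a point must
not exceed the rounded bound of `point_bound`. -/
lemma griesmer {m : Vec → ℕ} {d : ℕ} (h0 : m 0 = 0) (hw : ∀ v ≠ 0, d ≤ weight m v) :
    d + (d + 1) / 2 + (d + 3) / 4 + (d + 7) / 8 ≤ ∑ p, m p := by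
  set n := ∑ p, m p with hn
  set P := (7 * ((2 * n - 3 * d) / 2) - n) / 6 with hP
  have h1 : n ≤ 15 * P := by
    calc n ≤ ∑ p : Vec, if p = 0 then 0 else P := by
          refine Finset.sum_le_sum fun p _ => ?_
          split_ifs with h
          · rw [h, h0]
          · have := point_bound h0 hw h
            omega
      _ = 15 * P := by
          have hcard : (Finset.univ.filter fun p : Vec => ¬p = 0).card = 15 := by decide +kernel
          rw [Finset.sum_ite, Finset.sum_const, Finset.sum_const, hcard]
          simp
  have h2 : 3 * d ≤ 2 * n := by
    have := line_bound hw (p := Pi.single 0 1) (q := Pi.single 1 1) (by decide) (by decide)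
      (by decide)
    omega
  obtain ⟨a, b, hb, rfl⟩ : ∃ a b, b < 8 ∧ d = 8 * a + b :=
    ⟨d / 8, d % 8, Nat.mod_lt _ (by norm_num), (Nat.div_add_mod d 8).symm⟩
  clear_value P n
  interval_cases b <;> omega

/-- If all multiplicities are even, halving them and applying the Griesmer bound sharpens it. -/
lemma griesmer_of_even {m : Vec → ℕ} {d : ℕ} (h0 : m 0 = 0) (hw : ∀ v ≠ 0, d ≤ weight m v)
    (hm : ∀ p, Even (m p)) : ∃ k, ∑ p, m p = 2 * k ∧
      (d + 1) / 2 + ((d + 1) / 2 + 1) / 2 + ((d + 1) / 2 + 3) / 4 + ((d + 1) / 2 + 7) / 8 ≤ k := by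
  choose m' hm' using hm
  have hmm : m = 2 • m' := by ext p; simp [hm' p, two_mul]
  refine ⟨∑ p, m' p, by simp [hmm, Finset.mul_sum], griesmer (by have := hm' 0; omega) ?_⟩
  intro v hv
  have := hw v hv
  rw [hmm, weight_smul] at this
  omega

/-- When the point bound keeps all multiplicities below 3, they are even under locality 1. -/
lemma griesmer_of_two_valued {m : Vec → ℕ} {d : ℕ} (h0 : m 0 = 0)
    (hw : ∀ v ≠ 0, d ≤ weight m v) (hm : ∀ p, m p ≠ 1)
    (hP : 7 * ((2 * ∑ x, m x - 3 * d) / 2) < 18 + ∑ x, m x) : ∃ k, ∑ p, m p = 2 * k ∧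
      (d + 1) / 2 + ((d + 1) / 2 + 1) / 2 + ((d + 1) / 2 + 3) / 4 + ((d + 1) / 2 + 7) / 8 ≤ k := by
  refine griesmer_of_even h0 hw fun p => ?_
  by_cases hp : p = 0
  · simp [hp, h0]
  · have := point_bound h0 hw hp
    have := hm p
    have h : m p = 0 ∨ m p = 2 := by omega
    rcases h with h | h <;> simp [h]

/-! ### The cases with points of multiplicity 3 -/

/-- The parity vector of a multiset of points: the sum of the points of odd multiplicity. -/
def parityVec (m : Vec → ℕ) : Vec := ∑ p, (m p : ZMod 2) • p

lemma weight_cast (m : Vec → ℕ) (f : Vec) : (weight m f : ZMod 2) = f ⬝ᵥ parityVec m := by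
  have hz : ∀ a : ZMod 2, a ≠ 0 → a = 1 := by decide
  simp only [weight, parityVec, dotProduct_sum, dotProduct_smul, Nat.cast_sum, smul_eq_mul]
  refine Finset.sum_congr rfl fun p _ => ?_
  split_ifs with h
  · simp [h]
  · simp [hz _ h]

lemma odd_weight_iff (m : Vec → ℕ) (f : Vec) : Odd (weight m f) ↔ f ⬝ᵥ parityVec m ≠ 0 := by
  rw [← weight_cast, Ne, ZMod.natCast_eq_zero_iff_even, Nat.not_even_iff_odd]

lemma parityVec_eq_of_unique_odd {m : Vec → ℕ} {p : Vec} (hp : Odd (m p))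
    (huniq : ∀ q, Odd (m q) → q = p) : parityVec m = p := by
  rw [parityVec, Finset.sum_eq_single p, ZMod.natCast_eq_one_iff_odd.2 hp, one_smul]
  · intro q _ hq
    rw [ZMod.natCast_eq_zero_iff_even.2, zero_smul]
    exact Nat.not_odd_iff_even.1 fun h => hq (huniq q h)
  · simp

lemma exists_odd_of_odd_sum {m : Vec → ℕ} (h : Odd (∑ p, m p)) : ∃ p, Odd (m p) := by
  by_contra! hne
  refine Nat.not_even_iff_odd.2 h (Finset.even_sum _ fun p _ => ?_)
  exact Nat.not_odd_iff_even.1 (hne p)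

/-- Total weight of the codewords whose message is orthogonal to `p`. -/
lemma sum_weight_perp (m : Vec → ℕ) (h0 : m 0 = 0) {p : Vec} (hp : p ≠ 0) :
    (∑ f, if f ⬝ᵥ p = 0 then weight m f else 0) + 4 * m p = 4 * ∑ q, m q := by
  have hcard : ∀ p q : Vec, p ≠ 0 → (∑ f : Vec, if f ⬝ᵥ p = 0 ∧ f ⬝ᵥ q ≠ 0 then 1 else 0) =
      if q = 0 ∨ q = p then 0 else 4 := by decide +kernel
  have h1 : (∑ f, if f ⬝ᵥ p = 0 then weight m f else 0) =
      ∑ q, m q * (if q = 0 ∨ q = p then 0 else 4) := by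
    simp_rw [← hcard p _ hp, Finset.mul_sum]
    rw [Finset.sum_comm]
    refine Finset.sum_congr rfl fun f _ => ?_
    split_ifs with h
    · refine Finset.sum_congr rfl fun q _ => ?_
      by_cases hq : f ⬝ᵥ q = 0 <;> simp [h, hq]
    · simp [h]
  have h2 : 4 * m p = ∑ q, if q = p then 4 * m q else 0 := by simp
  rw [h1, h2, ← Finset.sum_add_distrib, Finset.mul_sum]
  refine Finset.sum_congr rfl fun q _ => ?_
  by_cases hq : q = p
  · simp [hq]
  · by_cases hq0 : q = 0
    · simp [hq0, h0]
    · simp [hq, hq0, mul_comm]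

/-- Total weight of all codewords. -/
lemma sum_weight (m : Vec → ℕ) (h0 : m 0 = 0) : ∑ f, weight m f = 8 * ∑ q, m q := by
  have hcard : ∀ q : Vec, (∑ f : Vec, if f ⬝ᵥ q = 0 then 0 else 1) =
      if q = 0 then 0 else 8 := by decide +kernel
  simp only [weight]
  rw [Finset.sum_comm, Finset.mul_sum]
  refine Finset.sum_congr rfl fun q _ => ?_
  have : ∀ f : Vec, (if f ⬝ᵥ q = 0 then 0 else m q) = m q * if f ⬝ᵥ q = 0 then 0 else 1 := by
    intro f; split_ifs <;> simp
  simp_rw [this]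
  rw [← Finset.mul_sum, hcard]
  split_ifs with h
  · simp [h, h0]
  · rw [mul_comm]

/-- No `[9, 4, 3]`- or `[13, 4, 5]`-code has locality 1: the only point of odd multiplicity would be
a point `p` of multiplicity 3, and then the seven codewords orthogonal to `p` have even weights, at
least `d + 1`, with sum only `4 * (n - 3)`. -/
lemma not_sum_nine_or_thirteen {m : Vec → ℕ} {d : ℕ} (h0 : m 0 = 0)
    (hw : ∀ v ≠ 0, d ≤ weight m v) (hm : ∀ p, m p ≠ 1) :
    ¬((d = 3 ∧ ∑ p, m p = 9) ∨ (d = 5 ∧ ∑ p, m p = 13)) := by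
  intro hdn
  have hne : ∀ {p}, Odd (m p) → p ≠ 0 := by rintro p hp rfl; simp [h0] at hp
  have h3 : ∀ {p}, Odd (m p) → m p = 3 := by
    intro p hp
    have := point_bound h0 hw (hne hp)
    have := hm p
    obtain ⟨k, hk⟩ := hp
    omega
  obtain ⟨p, hp⟩ := exists_odd_of_odd_sum (m := m) (by
    rcases hdn with h | h <;> rw [h.2] <;> decide)
  have ht : parityVec m = p := by
    refine parityVec_eq_of_unique_odd hp fun q hq => ?_
    by_contra hqp
    have := line_bound hw (hne hq) (hne hp) hqp
    have := h3 hp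
    have := h3 hq
    omega
  have hsum := sum_weight_perp m h0 (hne hp)
  have hcard : ∀ p : Vec, p ≠ 0 →
      (∑ f : Vec, if f ⬝ᵥ p = 0 then if f = 0 then 0 else d + 1 else 0) = 7 * (d + 1) := by
    rcases hdn with ⟨rfl, -⟩ | ⟨rfl, -⟩ <;> decide +kernel
  have hle : (∑ f : Vec, if f ⬝ᵥ p = 0 then if f = 0 then 0 else d + 1 else 0) ≤
      ∑ f, if f ⬝ᵥ p = 0 then weight m f else 0 := by
    refine Finset.sum_le_sum fun f _ => ?_
    split_ifs with hf hf0
    · simp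
    · have := hw f hf0
      have hodd := (odd_weight_iff m f).not
      rw [ht, not_not, Nat.not_odd_iff_even] at hodd
      obtain ⟨k, hk⟩ := hodd.2 hf
      omega
    · simp
  rw [hcard p (hne hp)] at hle
  have := h3 hp
  omega

/-- No `[21, 4, 10]`-code with locality 1. Let `t` be the parity vector. At a point `p` of
multiplicity 3 the seven orthogonal codewords have total weight 72, hence weights at most 12, and
fewer than four of them are odd, so `t = p` or `t = 0`. If `p` is the only such point, lowering its
multiplicity by one contradicts the bound for even multiplicities. Otherwise `t = 0`, which forces
all weights to be at most 12 and those not orthogonal to a triple point to be exactly 12; two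
triple points then make the total weight too large. -/
lemma sum_ne_twentyone {m : Vec → ℕ} (h0 : m 0 = 0) (hw : ∀ v ≠ 0, 10 ≤ weight m v)
    (hm : ∀ p, m p ≠ 1) : ∑ p, m p ≠ 21 := by
  intro hn
  have hne : ∀ {p}, Odd (m p) → p ≠ 0 := by rintro p hp rfl; simp [h0] at hp
  have h3 : ∀ {p}, Odd (m p) → m p = 3 := by
    intro p hp
    have := point_bound h0 hw (hne hp)
    have := hm p
    obtain ⟨k, hk⟩ := hp
    omega
  have hperp : ∀ {p}, Odd (m p) → (∑ f, if f ⬝ᵥ p = 0 then weight m f else 0) = 72 := by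
    intro p hp
    have := sum_weight_perp m h0 (hne hp)
    have := h3 hp
    omega
  have ht : ∀ {p}, Odd (m p) → parityVec m = 0 ∨ parityVec m = p := by
    intro p hp
    by_contra! hcon
    have hcard : ∀ p t : Vec, p ≠ 0 → t ≠ 0 → t ≠ p → (∑ f : Vec, if f ⬝ᵥ p = 0 then
        if f = 0 then 0 else if f ⬝ᵥ t ≠ 0 then 11 else 10 else 0) = 74 := by decide +kernel
    have hle := hcard p _ (hne hp) hcon.1 hcon.2
    have : (∑ f : Vec, if f ⬝ᵥ p = 0 then
        if f = 0 then 0 else if f ⬝ᵥ parityVec m ≠ 0 then 11 else 10 else 0) ≤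
        ∑ f, if f ⬝ᵥ p = 0 then weight m f else 0 := by
      refine Finset.sum_le_sum fun f _ => ?_
      split_ifs with hf hf0 hft
      · simp
      · have := hw f hf0
        obtain ⟨k, hk⟩ := (odd_weight_iff m f).2 hft
        omega
      · exact hw f hf0
      · simp
    have := hperp hp
    omega
  obtain ⟨p, hp⟩ := exists_odd_of_odd_sum (m := m) (by rw [hn]; decide)
  by_cases huniq : ∀ q, Odd (m q) → q = p
  · let m' : Vec → ℕ := Function.update m p 2
    have hmm : m = m' + Pi.single p 1 := by
      ext q
      by_cases hq : q = p
      · subst hq; simp [m', h3 hp]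
      · simp [m', hq]
    have hsum : ∑ q, m' q = 20 := by
      have : ∑ q, m q = ∑ q, m' q + 1 := by
        conv_lhs => rw [hmm]
        simp [Finset.sum_add_distrib]
      omega
    have hone : ∀ v, weight (Pi.single p 1) v ≤ 1 := by
      intro v
      calc weight (Pi.single p 1) v ≤ ∑ q, (Pi.single p 1 : Vec → ℕ) q := by
            refine Finset.sum_le_sum fun q _ => ?_
            split_ifs <;> simp
        _ = 1 := by simp
    have hm0 : m' 0 = 0 := by simp [m', Function.update_of_ne (hne hp).symm, h0]
    obtain ⟨k, hk, hk'⟩ := griesmer_of_even (d := 9) hm0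
      (fun v hv => by
        have h1 := hw v hv
        have h2 := hone v
        rw [hmm, weight_add] at h1
        omega)
      (fun q => by
        by_cases hq : q = p
        · subst hq; simp [m']
        · simpa [m', hq] using fun h => hq (huniq q h))
    omega
  · push Not at huniq
    obtain ⟨p', hp', hpp'⟩ := huniq
    have ht0 : parityVec m = 0 := by
      rcases ht hp with h | h
      · exact h
      · rcases ht hp' with h' | h'
        · exact h'
        · exact absurd (h'.symm.trans h) hpp'
    -- a nonzero weight orthogonal to a triple point is at most `72 - 6 * 10`
    have hle : ∀ f, weight m f ≤ 12 := by
      intro f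
      by_cases hf0 : f = 0
      · simp [hf0, weight_zero_right]
      obtain ⟨q, hq, hfq⟩ : ∃ q, Odd (m q) ∧ f ⬝ᵥ q = 0 := by
        by_contra! hcon
        have h1 : weight m f = ∑ q, m q - ∑ q, if f ⬝ᵥ q = 0 then m q else 0 := by
          rw [eq_comm, Nat.sub_eq_iff_eq_add]
          · rw [weight, ← Finset.sum_add_distrib]
            refine Finset.sum_congr rfl fun q _ => ?_
            split_ifs <;> simp
          · refine Finset.sum_le_sum fun q _ => ?_
            split_ifs <;> simp
        have h2 : Even (∑ q, if f ⬝ᵥ q = 0 then m q else 0) := by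
          refine Finset.even_sum _ fun q _ => ?_
          split_ifs with h
          · exact Nat.not_odd_iff_even.1 fun h' => hcon q h' h
          · exact Even.zero
        have h3 := (odd_weight_iff m f).not.2 (by simp [ht0])
        rw [Nat.not_odd_iff_even] at h3
        have h4 := hw f hf0
        rw [hn] at h1
        obtain ⟨a, ha⟩ := h2
        obtain ⟨b, hb⟩ := h3
        omega
      have hcard : ∀ q f : Vec, q ≠ 0 → f ≠ 0 → f ⬝ᵥ q = 0 → (∑ g : Vec,
          if g = f then 0 else if g ⬝ᵥ q = 0 then if g = 0 then 0 else 10 else 0) = 60 := by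
        decide +kernel
      have h1 : (∑ g : Vec, if g = f then 0 else
          if g ⬝ᵥ q = 0 then if g = 0 then 0 else 10 else 0) +
          (∑ g, if g = f then weight m f else 0) ≤
          ∑ g, if g ⬝ᵥ q = 0 then weight m g else 0 := by
        rw [← Finset.sum_add_distrib]
        refine Finset.sum_le_sum fun g _ => ?_
        by_cases hgf : g = f
        · simp [hgf, hfq]
        · by_cases hg0 : g = 0
          · simp [hg0, Ne.symm hf0]
          · by_cases hgq : g ⬝ᵥ q = 0
            · simpa [hgf, hg0, hgq] using hw g hg0
            · simp [hgf, hgq]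
      rw [hcard q f (hne hq) hf0 hfq, hperp hq] at h1
      simp at h1
      omega
    have htot := sum_weight m h0
    -- the eight weights not orthogonal to a triple point sum to `168 - 72 = 8 * 12`
    have heq : ∀ {q}, Odd (m q) → ∀ f, f ⬝ᵥ q ≠ 0 → weight m f = 12 := by
      intro q hq f hf
      have h1 : (∑ g, if g ⬝ᵥ q = 0 then weight m g else 0) +
          (∑ g, if g ⬝ᵥ q = 0 then 0 else weight m g) = ∑ g, weight m g := by
        rw [← Finset.sum_add_distrib]
        refine Finset.sum_congr rfl fun g _ => ?_
        split_ifs <;> simp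
      have hcard : ∀ q : Vec, q ≠ 0 → (∑ g : Vec, if g ⬝ᵥ q = 0 then 0 else 12) = 96 := by
        decide +kernel
      by_contra hlt
      have h2 : (∑ g, if g ⬝ᵥ q = 0 then 0 else weight m g) <
          ∑ g : Vec, if g ⬝ᵥ q = 0 then 0 else 12 := by
        refine Finset.sum_lt_sum (fun g _ => ?_) ⟨f, Finset.mem_univ _, ?_⟩
        · split_ifs
          · exact le_rfl
          · exact hle g
        · rw [if_neg hf, if_neg hf]
          exact lt_of_le_of_ne (hle f) hlt
      have := hcard q (hne hq)
      have := hperp hq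
      omega
    have hcard : ∀ p p' : Vec, p ≠ 0 → p' ≠ 0 → p' ≠ p → (∑ f : Vec, if f = 0 then 0 else
        if f ⬝ᵥ p ≠ 0 ∨ f ⬝ᵥ p' ≠ 0 then 12 else 10) = 174 := by decide +kernel
    have h1 : (∑ f : Vec, if f = 0 then 0 else
        if f ⬝ᵥ p ≠ 0 ∨ f ⬝ᵥ p' ≠ 0 then 12 else 10) ≤ ∑ f, weight m f := by
      refine Finset.sum_le_sum fun f _ => ?_
      split_ifs with hf0 hf
      · simp
      · rcases hf with hf | hf
        · exact (heq hp f hf).ge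
        · exact (heq hp' f hf).ge
      · exact hw f hf0
    rw [hcard p p' (hne hp) (hne hp') hpp'] at h1
    omega

/-! ### Constructions -/

/-- The multiplicity function taking the value 1 at each of the 15 points; it generates the
simplex code. -/
def simplex (p : Vec) : ℕ := if p = 0 then 0 else 1

lemma weight_simplex {v : Vec} (hv : v ≠ 0) : weight simplex v = 8 := by
  revert v; decide +kernel

lemma sum_simplex : ∑ p, simplex p = 15 := by decide +kernel

/-- Point sets of codes of dimension 4 and minimum distance `r < 8` meeting the Griesmer bound:
a basis, a frame, and for `3 ≤ r` the complement of a plane, a line, a point or a union of these. -/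
def optimalPoints (r : ℕ) (p : Vec) : ℕ :=
  match r with
  | 1 => if hammingNorm p = 1 then 1 else 0
  | 2 => if hammingNorm p = 1 ∨ hammingNorm p = 4 then 1 else 0
  | 3 => if p 3 = 1 ∧ p ≠ Pi.single 3 1 then 1 else 0
  | 4 => if p 3 = 1 then 1 else 0
  | 5 => if (p 2 = 1 ∨ p 3 = 1) ∧ p ≠ Pi.single 3 1 then 1 else 0
  | 6 => if p 2 = 1 ∨ p 3 = 1 then 1 else 0
  | 7 => if p ≠ 0 ∧ p ≠ Pi.single 3 1 then 1 else 0
  | _ => 0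

lemma le_weight_optimalPoints {r : ℕ} (hr : r < 8) {v : Vec} (hv : v ≠ 0) :
    r ≤ weight (optimalPoints r) v := by
  revert r v; decide +kernel

lemma sum_optimalPoints {r : ℕ} (hr : r < 8) :
    ∑ p, optimalPoints r p = r + (r + 1) / 2 + (r + 3) / 4 + (r + 7) / 8 := by
  revert r; decide +kernel

/-- Two copies of the simplex code leave no multiplicity 1, so from distance 16 on every residue of
`d` modulo 8 is covered by a code meeting the Griesmer bound. -/
lemma minLengthLRC_le_griesmer {d : ℕ} (hd : 16 ≤ d) : minLengthLRC (ZMod 2) 4 d 1 ≤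
    ((d + (d + 1) / 2 + (d + 3) / 4 + (d + 7) / 8 : ℕ) : ℕ∞) := by
  have hr : d % 8 < 8 := Nat.mod_lt _ (by norm_num)
  refine minLengthLRC_le _ ((d / 8) • simplex + optimalPoints (d % 8)) (by omega) ?_ ?_ ?_
  · simp only [Pi.add_apply, Pi.smul_apply, smul_eq_mul, Finset.sum_add_distrib]
    rw [← Finset.mul_sum, sum_simplex, sum_optimalPoints hr]
    omega
  · intro p
    by_cases hp : p = 0
    · have h : ∀ r < 8, optimalPoints r 0 ≠ 1 := by decide +kernel
      simpa [hp, simplex] using h _ hr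
    · simp only [Pi.add_apply, Pi.smul_apply, smul_eq_mul, simplex, if_neg hp]
      omega
  · intro v hv
    rw [weight_add, weight_smul, weight_simplex hv]
    have := le_weight_optimalPoints hr hv
    omega

/-- Doubling every point of a code gives locality 1. -/
lemma minLengthLRC_le_double {r d : ℕ} (N : ℕ) (hr : r < 8) (hd : 1 ≤ d) (hdr : d ≤ 2 * r)
    (hN : 2 * (r + (r + 1) / 2 + (r + 3) / 4 + (r + 7) / 8) = N) :
    minLengthLRC (ZMod 2) 4 d 1 ≤ N := by
  refine minLengthLRC_le N (2 • optimalPoints r) hd ?_ (fun p => ?_) fun v hv => ?_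
  · simp only [Pi.smul_apply, smul_eq_mul]
    rw [← Finset.mul_sum, sum_optimalPoints hr, hN]
  · simp only [Pi.smul_apply, smul_eq_mul]
    omega
  · have := le_weight_optimalPoints hr hv
    rw [weight_smul]
    omega

lemma minLengthLRC_mono {d d' : ℕ} (hd : d ≤ d') :
    minLengthLRC (ZMod 2) 4 d 1 ≤ minLengthLRC (ZMod 2) 4 d' 1 := by
  refine le_iInf₂ ?_
  rintro n ⟨C, ⟨hk, hC⟩, hloc⟩
  exact iInf₂_le _ ⟨C, ⟨hk, fun c hc c' hc' hne => hd.trans (hC c hc c' hc' hne)⟩, hloc⟩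

/-- Distance 9: the complement of a plane, doubled, with a third copy of a basis contained in it. -/
lemma minLengthLRC_nine_le : minLengthLRC (ZMod 2) 4 9 1 ≤ (20 : ℕ) :=
  minLengthLRC_le 20
    (fun p => if p 3 = 1 then if hammingNorm p ≤ 2 then 3 else 2 else 0)
    (by norm_num) (by decide +kernel) (by decide +kernel) (by decide +kernel)

/-- Distance 11: the complement of a plane, tripled, with one copy of one point removed. -/
lemma minLengthLRC_eleven_le : minLengthLRC (ZMod 2) 4 11 1 ≤ (23 : ℕ) :=
  minLengthLRC_le 23
    (fun p => if p 3 = 1 then if p = Pi.single 3 1 then 2 else 3 else 0)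
    (by norm_num) (by decide +kernel) (by decide +kernel) (by decide +kernel)

/-- Distance 13: the complement of the line `p 2 = p 3 = 0`, doubled, with a third copy of three
independent points of the plane `p 2 = 0`. -/
lemma minLengthLRC_thirteen_le : minLengthLRC (ZMod 2) 4 13 1 ≤ (27 : ℕ) :=
  minLengthLRC_le 27
    (fun p => if p 2 = 1 then 2 else if p 3 = 1 then if hammingNorm p ≤ 2 then 3 else 2 else 0)
    (by norm_num) (by decide +kernel) (by decide +kernel) (by decide +kernel)

/-! ### Lower bounds at small distances -/

/-- At distance 1 the halved multiplicities still define a code. -/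
lemma eight_le_minLengthLRC : ((8 : ℕ) : ℕ∞) ≤ minLengthLRC (ZMod 2) 4 1 1 := by
  refine le_minLengthLRC fun m h0 hw hm => ?_
  let m' : Vec → ℕ := fun p => m p / 2
  have h1 : ∀ v ≠ 0, 1 ≤ weight m' v := by
    intro v hv
    by_contra hlt
    have hz : weight m' v = 0 := by omega
    have : weight m v = 0 := by
      rw [weight, Finset.sum_eq_zero_iff] at hz ⊢
      intro p hp
      have h2 := hz p hp
      have := hm p
      simp only [m'] at h2
      split_ifs at h2 ⊢ <;> omega
    have := hw v hv
    omega
  have h2 := griesmer (m := m') (by simp [m', h0]) h1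
  have h3 : 2 * ∑ p, m' p ≤ ∑ p, m p := by
    rw [Finset.mul_sum]
    refine Finset.sum_le_sum fun p _ => ?_
    simp only [m']
    omega
  omega

/-- The lengths from the Griesmer bound up to `N - 1` are excluded by halving, except where a point of
multiplicity 3 is possible. -/
lemma le_minLengthLRC_of_distance {d N : ℕ} (h : (d, N) ∈ [(3, 10), (5, 14), (7, 16), (9, 20),
    (10, 22), (11, 23), (12, 24), (13, 27), (14, 28), (15, 30)]) :
    (N : ℕ∞) ≤ minLengthLRC (ZMod 2) 4 d 1 := by
  refine le_minLengthLRC fun m h0 hw hm => ?_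
  by_contra! hlt
  have hg := griesmer h0 hw
  have htwo := griesmer_of_two_valued h0 hw hm
  have h13 := not_sum_nine_or_thirteen h0 hw hm
  have h21 : d = 10 → ∑ p, m p ≠ 21 := by rintro rfl; exact sum_ne_twentyone h0 hw hm
  generalize ∑ p, m p = n at *
  simp only [List.mem_cons, Prod.mk.injEq, List.not_mem_nil, or_false] at h
  rcases h with ⟨rfl, rfl⟩ | ⟨rfl, rfl⟩ | ⟨rfl, rfl⟩ | ⟨rfl, rfl⟩ | ⟨rfl, rfl⟩ | ⟨rfl, rfl⟩ |
    ⟨rfl, rfl⟩ | ⟨rfl, rfl⟩ | ⟨rfl, rfl⟩ | ⟨rfl, rfl⟩ <;>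
  · norm_num at hg h13 h21
    obtain ⟨k, hk, hk'⟩ := htwo (by omega)
    omega

theorem mainTheorem9 :
    minLengthLRC (ZMod 2) 4 1 1 = 8 ∧
    minLengthLRC (ZMod 2) 4 2 1 = 8 ∧
    minLengthLRC (ZMod 2) 4 3 1 = 10 ∧
    minLengthLRC (ZMod 2) 4 4 1 = 10 ∧
    minLengthLRC (ZMod 2) 4 5 1 = 14 ∧
    minLengthLRC (ZMod 2) 4 6 1 = 14 ∧
    minLengthLRC (ZMod 2) 4 7 1 = 16 ∧
    minLengthLRC (ZMod 2) 4 8 1 = 16 ∧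
    minLengthLRC (ZMod 2) 4 9 1 = 20 ∧
    minLengthLRC (ZMod 2) 4 10 1 = 22 ∧
    minLengthLRC (ZMod 2) 4 11 1 = 23 ∧
    minLengthLRC (ZMod 2) 4 12 1 = 24 ∧
    minLengthLRC (ZMod 2) 4 13 1 = 27 ∧
    minLengthLRC (ZMod 2) 4 14 1 = 28 ∧
    minLengthLRC (ZMod 2) 4 15 1 = 30 ∧
    ∀ d : ℕ, 16 ≤ d →
      minLengthLRC (ZMod 2) 4 d 1 = minLength (ZMod 2) 4 d ∧ minLengthLRC (ZMod 2) 4 d 1 ≠ ⊤ := by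
  refine ⟨?_, ?_, ?_, ?_, ?_, ?_, ?_, ?_, ?_, ?_, ?_, ?_, ?_, ?_, ?_, fun d hd => ?_⟩
  · exact le_antisymm (minLengthLRC_le_double (r := 1) 8 (by simp) (by simp) (by simp) (by simp))
      eight_le_minLengthLRC
  · exact le_antisymm (minLengthLRC_le_double (r := 1) 8 (by simp) (by simp) (by simp) (by simp))
      (eight_le_minLengthLRC.trans (minLengthLRC_mono (by norm_num)))
  · exact le_antisymm (minLengthLRC_le_double (r := 2) 10 (by simp) (by simp) (by simp) (by simp))
      (le_minLengthLRC_of_distance (d := 3) (N := 10) (by simp))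
  · exact le_antisymm (minLengthLRC_le_double (r := 2) 10 (by simp) (by simp) (by simp) (by simp))
      ((le_minLengthLRC_of_distance (d := 3) (N := 10) (by simp)).trans
        (minLengthLRC_mono (by norm_num)))
  · exact le_antisymm (minLengthLRC_le_double (r := 3) 14 (by simp) (by simp) (by simp) (by simp))
      (le_minLengthLRC_of_distance (d := 5) (N := 14) (by simp))
  · exact le_antisymm (minLengthLRC_le_double (r := 3) 14 (by simp) (by simp) (by simp) (by simp))
      ((le_minLengthLRC_of_distance (d := 5) (N := 14) (by simp)).trans
        (minLengthLRC_mono (by norm_num)))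
  · exact le_antisymm (minLengthLRC_le_double (r := 4) 16 (by simp) (by simp) (by simp) (by simp))
      (le_minLengthLRC_of_distance (d := 7) (N := 16) (by simp))
  · exact le_antisymm (minLengthLRC_le_double (r := 4) 16 (by simp) (by simp) (by simp) (by simp))
      ((le_minLengthLRC_of_distance (d := 7) (N := 16) (by simp)).trans
        (minLengthLRC_mono (by norm_num)))
  · exact le_antisymm minLengthLRC_nine_le
      (le_minLengthLRC_of_distance (d := 9) (N := 20) (by simp))
  · exact le_antisymm (minLengthLRC_le_double (r := 5) 22 (by simp) (by simp) (by simp) (by simp))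
      (le_minLengthLRC_of_distance (d := 10) (N := 22) (by simp))
  · exact le_antisymm minLengthLRC_eleven_le
      (le_minLengthLRC_of_distance (d := 11) (N := 23) (by simp))
  · exact le_antisymm (minLengthLRC_le_double (r := 6) 24 (by simp) (by simp) (by simp) (by simp))
      (le_minLengthLRC_of_distance (d := 12) (N := 24) (by simp))
  · exact le_antisymm minLengthLRC_thirteen_le
      (le_minLengthLRC_of_distance (d := 13) (N := 27) (by simp))
  · exact le_antisymm (minLengthLRC_le_double (r := 7) 28 (by simp) (by simp) (by simp) (by simp))
      (le_minLengthLRC_of_distance (d := 14) (N := 28) (by simp))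
  · exact le_antisymm ((minLengthLRC_mono (by norm_num)).trans (minLengthLRC_le_griesmer (d := 16) le_rfl))
      (le_minLengthLRC_of_distance (d := 15) (N := 30) (by simp))
  · have hle := minLengthLRC_le_griesmer hd
    refine ⟨le_antisymm (hle.trans (le_minLength fun m h0 hw => griesmer h0 hw))
      (minLength_le_minLengthLRC d 1), ne_top_of_le_ne_top (ENat.natCast_ne_top _) hle⟩
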